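/- Let $n$ be a positive integer, and write a permutation $w\in S_n$ in one-line notation as $w(1)\cdots w(n)$. The odd diagram of $w$ is $$D_o(w)=\{(i,j)\in[n]\times[n] : w(i)>j,\ i<w^{-1}(j),\ i\not\equiv w^{-1}(j)\pmod 2\},$$ and the odd diagram class of a set $D\subseteq[n]\times[n]$ is $\mathrm{Perm}(D)=\{w\in S_n : D_o(w)=D\}$. Let $w\,(i\ j)$ denote $w$ with its entries in positions $i$ and $j$ exchanged, and let $\le$ be the Bruhat order on $S_n$, that is, the reflexive and transitive closure of the relations $w<w\,(i\ j)$ for $i<j$ with $w(i)<w(j)$. Let $u,v\in S_n$ be such that the Bruhat interval $[u,v]=\{w : u\le w\le v\}$ is an odd diagram class and has more than one element. Put $$k=d(u,v)=\min\{i : u^{-1}(i)\ne v^{-1}(i)\},\qquad a=u^{-1}(k),\qquad b=v^{-1}(k).$$ Let $a_1<\cdots<a_m$ be the elements of $\{i : a\le i\le b,\ u(a)\le u(i)\le u(b)\}$, and for $1\le i\le m$ put $$[u,v]^{(i)}=\{w\in[u,v] : w^{-1}(k)=a_i\}.$$ Then: 1. $a<b$ and $u(a)<u(b)$ (so that $a_1=a$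 and $a_m=b$). 2. The sets $[u,v]^{(1)},\dots,[u,v]^{(m)}$ are nonempty and pairwise disjoint, and their union is $[u,v]$. 3. The sets $[u,v]^{(1)},\dots,[u,v]^{(m)}$ all have the same cardinality. 4. For $1\le i<m$, the map $w\mapsto w\,(a_i\ a_{i+1})$ is a bijection from $[u,v]^{(i)}$ onto $[u,v]^{(i+1)}$. 5. For $1\le i<m$, every $w\in[u,v]^{(i)}$ is covered by $w\,(a_i\ a_{i+1})$ in the Bruhat order, that is, $w<w\,(a_i\ a_{i+1})$ and no $x\in S_n$ satisfies $w<x<w\,(a_i\ a_{i+1})$. -/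

import Mathlib

/-!  Permutations of `[n]` are `Equiv.Perm (Fin n)`. Positions and values are numbered
`0, …, n - 1` rather than `1, …, n`; only the order and the relation "same parity" of positions
are used, and neither is affected by the shift. -/

namespace OddDiagram

/-- The odd diagram of `w`: the boxes `(i, j)` (row `i`, column `j`) with `w(i) > j`,
`i < w⁻¹(j)` and `i ≢ w⁻¹(j) (mod 2)`. -/
def oddDiagram {n : ℕ} (w : Equiv.Perm (Fin n)) : Set (Fin n × Fin n) :=
  {x | x.2 < w x.1 ∧ x.1 < w⁻¹ x.2 ∧ ¬ (x.1 : ℕ) ≡ (w⁻¹ x.2 : ℕ) [MOD 2]}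

/-- The set `Perm(D)` of all permutations whose odd diagram is `D`. -/
def oddDiagramClass {n : ℕ} (D : Set (Fin n × Fin n)) : Set (Equiv.Perm (Fin n)) :=
  {w | oddDiagram w = D}

/-- The generating relation of the Bruhat order: `w < w (i j)` for positions `i < j` with
`w(i) < w(j)`. In Lean `w * Equiv.swap i j` is `w` with the entries in positions `i` and `j`
exchanged. -/
def BruhatStep {n : ℕ} (w w' : Equiv.Perm (Fin n)) : Prop :=
  ∃ i j : Fin n, i < j ∧ w i < w j ∧ w' = w * Equiv.swap i j

/-- The Bruhat order `u ≤ v`. -/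
def BruhatLE {n : ℕ} (u v : Equiv.Perm (Fin n)) : Prop :=
  Relation.ReflTransGen BruhatStep u v

/-- The strict Bruhat order `u < v`. -/
def BruhatLT {n : ℕ} (u v : Equiv.Perm (Fin n)) : Prop :=
  BruhatLE u v ∧ u ≠ v

/-- `u` is covered by `v` in the Bruhat order. -/
def BruhatCovBy {n : ℕ} (u v : Equiv.Perm (Fin n)) : Prop :=
  BruhatLT u v ∧ ¬ ∃ w, BruhatLT u w ∧ BruhatLT w v

/-- The Bruhat interval `[u, v]`. -/
def bruhatInterval {n : ℕ} (u v : Equiv.Perm (Fin n)) : Set (Equiv.Perm (Fin n)) :=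
  {w | BruhatLE u w ∧ BruhatLE w v}

/-- `k = d(u, v)`: the smallest value that lies in different positions in `u` and in `v`. -/
def IsFirstDiff {n : ℕ} (u v : Equiv.Perm (Fin n)) (k : Fin n) : Prop :=
  IsLeast {i | u⁻¹ i ≠ v⁻¹ i} k

/-- The positions between `a` and `b` whose `u`-values lie in `[u(a), u(b)]`. -/
def positions {n : ℕ} (u : Equiv.Perm (Fin n)) (a b : Fin n) : Set (Fin n) :=
  {i | a ≤ i ∧ i ≤ b ∧ u a ≤ u i ∧ u i ≤ u b}

/-- The part of `[u, v]` in which the value `k` is in position `p`. -/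
def block {n : ℕ} (u v : Equiv.Perm (Fin n)) (k p : Fin n) : Set (Equiv.Perm (Fin n)) :=
  {w | w ∈ bruhatInterval u v ∧ w⁻¹ k = p}

end OddDiagram

namespace OddDiagram

open Equiv

variable {n : ℕ}

/-! All of `[u, v]` shares the odd diagram `D`, and `D` alone decides membership. Rank functions
show that inside `[u, v]` the values below `k` stay put and `k` stays between positions `a` and `b`.
Comparing column `k` of the diagrams of `u` and `v` forces the positions in `[a, b]` with entries `≥
k` to have one parity (`modEq_of_oddDiagram_eq`).

The key point is that `positions u a b` consists of those of these positions whose row of `D` is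
empty beyond column `k`, a condition that does not depend on `w`. Exchanging `k` with the entry in
such a position preserves `D` (`oddDiagram_mul_swap`), so it stays in the interval and matches any
two blocks.

For the covering relation (`bruhatCovBy_mul_swap`), an entry above `k` strictly between two
consecutive positions has a box beyond column `k`. The box comes from a smaller entry to the right
of `b`, and that entry exceeds `w (p j)` because row `p j` is empty there. -/

/-! ### Bruhat order: rank and weight as monotone statistics -/

/-- Serves both `rank` and `weight`, which are sums of this shape. -/
theorem sum_mul_swap (g : Fin n → Fin n → ℤ) (w : Perm (Fin n)) {i j : Fin n} (h : i ≠ j) :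
    ∑ x, g x ((w * swap i j) x) =
      ∑ x, g x (w x) + (g i (w j) + g j (w i) - g i (w i) - g j (w j)) := by
  have hj : j ∈ Finset.univ.erase i := by simp [h.symm]
  rw [← Finset.add_sum_erase _ _ (Finset.mem_univ i), ← Finset.add_sum_erase _ _ hj,
    ← Finset.add_sum_erase _ (fun x => g x (w x)) (Finset.mem_univ i),
    ← Finset.add_sum_erase _ (fun x => g x (w x)) hj]
  have : ∑ x ∈ (Finset.univ.erase i).erase j, g x ((w * swap i j) x) =
      ∑ x ∈ (Finset.univ.erase i).erase j, g x (w x) := by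
    refine Finset.sum_congr rfl fun x hx => ?_
    simp only [Finset.mem_erase, Finset.mem_univ, and_true] at hx
    rw [Perm.mul_apply, swap_apply_of_ne_of_ne hx.2 hx.1]
  rw [this]
  simp only [Perm.mul_apply, swap_apply_left, swap_apply_right]
  ring

/-- The number of positions `x ≤ s` with `w x ≤ t`. -/
def rank (w : Perm (Fin n)) (s t : Fin n) : ℤ :=
  ∑ x, if x ≤ s ∧ w x ≤ t then 1 else 0

theorem rank_mul_swap (w : Perm (Fin n)) {i j : Fin n} (hij : i < j) (hw : w i < w j)
    (s t : Fin n) :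
    rank (w * swap i j) s t =
      rank w s t - if i ≤ s ∧ s < j ∧ w i ≤ t ∧ t < w j then 1 else 0 := by
  unfold rank
  rw [sum_mul_swap (fun x y => if x ≤ s ∧ y ≤ t then 1 else 0) w hij.ne]
  grind

theorem BruhatLE.rank_le {u w : Perm (Fin n)} (h : BruhatLE u w) (s t : Fin n) :
    rank w s t ≤ rank u s t := by
  induction h with
  | refl => rfl
  | tail _ h ih =>
    obtain ⟨i, j, hij, hw, rfl⟩ := h
    rw [rank_mul_swap _ hij hw]
    split_ifs <;> linarith

/-- The sum of `x * w x` over all positions `x`; it strictly decreases along Bruhat steps. -/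
def weight (w : Perm (Fin n)) : ℤ := ∑ x : Fin n, ((x : ℕ) : ℤ) * ((w x : ℕ) : ℤ)

theorem BruhatStep.weight_lt {u w : Perm (Fin n)} (h : BruhatStep u w) : weight w < weight u := by
  obtain ⟨i, j, hij, hw, rfl⟩ := h
  unfold weight
  rw [sum_mul_swap (fun x y => ((x : ℕ) : ℤ) * ((y : ℕ) : ℤ)) u hij.ne]
  have h1 : ((i : ℕ) : ℤ) < (j : ℕ) := by exact_mod_cast hij
  have h2 : ((u i : ℕ) : ℤ) < (u j : ℕ) := by exact_mod_cast hw
  nlinarith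

theorem BruhatLE.weight_le {u w : Perm (Fin n)} (h : BruhatLE u w) : weight w ≤ weight u := by
  induction h with
  | refl => rfl
  | tail _ h ih => exact h.weight_lt.le.trans ih

theorem not_bruhatLE_of_step {u w : Perm (Fin n)} (h : BruhatStep u w) : ¬ BruhatLE w u :=
  fun h' => absurd h'.weight_le (not_le.2 h.weight_lt)

theorem BruhatLE.antisymm {u w : Perm (Fin n)} (h : BruhatLE u w) (h' : BruhatLE w u) :
    u = w := by
  rcases Relation.ReflTransGen.cases_head h with h | ⟨x, hux, hxw⟩
  · exact h
  · exact absurd (Relation.ReflTransGen.trans hxw h') (not_bruhatLE_of_step hux)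

/-- If `u ≤ w` agree on the positions of all values below `j`, then `j` moves weakly right. -/
theorem BruhatLE.inv_apply_le {u w : Perm (Fin n)} (h : BruhatLE u w) {j : Fin n}
    (hj : ∀ i < j, u⁻¹ i = w⁻¹ i) : u⁻¹ j ≤ w⁻¹ j := by
  by_contra! hlt
  -- Count by values instead of positions: values below `j` contribute equally to both ranks, while
  -- `j` itself is counted for `w` only.
  have hr := h.rank_le (w⁻¹ j) j
  have key (z : Perm (Fin n)) (s t : Fin n) :
      rank z s t = ∑ y, if z⁻¹ y ≤ s ∧ y ≤ t then 1 else 0 := by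
    unfold rank
    rw [← Equiv.sum_comp z⁻¹]
    simp
  rw [key, key] at hr
  refine absurd hr (not_le.2 (Finset.sum_lt_sum (fun y _ => ?_) ⟨j, Finset.mem_univ j, ?_⟩))
  · rcases lt_trichotomy y j with hy | rfl | hy
    · rw [hj y hy]
    · rw [if_neg fun h => not_le.2 hlt h.1]
      positivity
    · simp [not_le.2 hy]
  · rw [if_neg fun h => not_le.2 hlt h.1]
    simp

/-- A step lowers the rank by one exactly on a rectangle. The first step of a chain from `w` to `w *
swap i j` must have its rectangle inside that of `(i, j)`; since no entry lies inside the latter,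
the two steps coincide. -/
theorem bruhatCovBy_mul_swap (w : Perm (Fin n)) {i j : Fin n} (hij : i < j) (hw : w i < w j)
    (h : ∀ x, i < x → x < j → w i < w x → w j < w x) : BruhatCovBy w (w * swap i j) := by
  have hs : BruhatStep w (w * swap i j) := ⟨i, j, hij, hw, rfl⟩
  refine ⟨⟨.single hs, fun e => not_bruhatLE_of_step hs (e ▸ .refl)⟩, ?_⟩
  rintro ⟨x, ⟨hwx, hne⟩, hxv, hne'⟩
  rcases Relation.ReflTransGen.cases_head hwx with e | ⟨y, ⟨i', j', hij', hw', rfl⟩, hyx⟩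
  · exact hne e
  have hle := hyx.trans hxv
  have hsub : ∀ s t, i' ≤ s → s < j' → w i' ≤ t → t < w j' →
      i ≤ s ∧ s < j ∧ w i ≤ t ∧ t < w j := by
    intro s t h1 h2 h3 h4
    have := BruhatLE.rank_le hle s t
    rw [rank_mul_swap _ hij hw, rank_mul_swap _ hij' hw'] at this
    by_contra hc
    rw [if_neg hc, if_pos ⟨h1, h2, h3, h4⟩] at this
    linarith
  have hlow := hsub i' (w i') le_rfl hij' le_rfl hw'
  -- The inclusion of half-open rectangles is tested at suitable corner points.
  have hj : j' ≤ j := by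
    by_contra! hc
    exact absurd (hsub j (w i') (hlow.2.1.le) hc le_rfl hw').2.1 (lt_irrefl _)
  have hwj : w j' ≤ w j := by
    by_contra! hc
    exact absurd (hsub i' (w j) le_rfl hij' (hlow.2.2.2.le) hc).2.2.2 (lt_irrefl _)
  have hi : i' = i := by
    by_contra hne
    have h1 : i < i' := lt_of_le_of_ne hlow.1 (Ne.symm hne)
    have h2 : w i < w i' := lt_of_le_of_ne hlow.2.2.1 fun e => hne (w.injective e).symm
    exact absurd (h i' h1 hlow.2.1 h2) (not_lt.2 hlow.2.2.2.le)
  have hj' : j' = j := by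
    by_contra hne
    have h1 : j' < j := lt_of_le_of_ne hj hne
    subst hi
    exact absurd (h j' hij' h1 hw') (not_lt.2 hwj)
  subst hi hj'
  exact hne' (BruhatLE.antisymm hxv hyx)

/-! ### Odd diagrams under exchanges of entries -/

theorem mk_apply_mem_oddDiagram (w : Perm (Fin n)) (x y : Fin n) :
    (x, w y) ∈ oddDiagram w ↔ w y < w x ∧ x < y ∧ ¬ (x : ℕ) ≡ y [MOD 2] := by
  simp [oddDiagram]

/-- Exchanging entries in positions of the same parity preserves the odd diagram, provided that
the entries in positions of the other parity do not interfere. -/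
theorem oddDiagram_mul_swap (w : Perm (Fin n)) {i j : Fin n} (hij : i < j) (hw : w i < w j)
    (hpar : (i : ℕ) ≡ j [MOD 2])
    (hmid : ∀ x, i < x → x < j → ¬ (i : ℕ) ≡ x [MOD 2] → w x < w i)
    (hright : ∀ x, j < x → ¬ (i : ℕ) ≡ x [MOD 2] → w i < w x → w j < w x) :
    oddDiagram (w * swap i j) = oddDiagram w := by
  ext ⟨x, c⟩
  obtain ⟨y, rfl⟩ := w.surjective c
  rw [mk_apply_mem_oddDiagram]
  -- The column is a fixed value, so its position in the new permutation is `swap i j y`.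
  have e : w y = (w * swap i j) (swap i j y) := by simp
  rw [e, mk_apply_mem_oddDiagram, ← e, Perm.mul_apply]
  have hinj : ∀ x y, w x = w y → x = y := fun x y h => w.injective h
  simp only [Nat.ModEq] at *
  have h1 := hinj i y
  have h2 := hinj j y
  have h3 := hmid y
  have h4 := hright y
  have h5 := hmid x
  have h6 := hright x
  rw [swap_apply_def, swap_apply_def]
  split_ifs <;> subst_vars <;> grind

/-- As `oddDiagram_mul_swap`, but for an exchange that goes down in the Bruhat order. -/
theorem oddDiagram_mul_swap_of_gt (w : Perm (Fin n)) {i j : Fin n} (hij : i < j) (hw : w j < w i)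
    (hpar : (i : ℕ) ≡ j [MOD 2])
    (hmid : ∀ x, i < x → x < j → ¬ (i : ℕ) ≡ x [MOD 2] → w x < w j)
    (hright : ∀ x, j < x → ¬ (i : ℕ) ≡ x [MOD 2] → w j < w x → w i < w x) :
    oddDiagram (w * swap i j) = oddDiagram w := by
  have hne (x : Fin n) (hx : ¬ (i : ℕ) ≡ x [MOD 2]) : swap i j x = x :=
    swap_apply_of_ne_of_ne (by rintro rfl; exact hx rfl) (by rintro rfl; exact hx hpar)
  have := oddDiagram_mul_swap (w * swap i j) hij (by simpa using hw) hpar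
    (fun x h1 h2 h3 => by simpa [hne x h3] using hmid x h1 h2 h3)
    (fun x h1 h2 => by simpa [hne x h2] using hright x h1 h2)
  rw [← this, mul_swap_mul_self]

/-- Values below the first difference of `u` and `v` do not move inside `[u, v]`. -/
theorem inv_apply_eq_of_mem {u v w : Perm (Fin n)} (hw : w ∈ bruhatInterval u v) {k : Fin n}
    (hk : ∀ i < k, u⁻¹ i = v⁻¹ i) (j : Fin n) (hj : j < k) : w⁻¹ j = u⁻¹ j := by
  induction j using WellFoundedLT.induction with
  | ind j ih =>
    have h1 := hw.1.inv_apply_le (j := j) fun i hi => (ih i hi (hi.trans hj)).symm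
    have h2 := hw.2.inv_apply_le (j := j) fun i hi =>
      (ih i hi (hi.trans hj)).trans (hk i (hi.trans hj))
    rw [← hk j hj] at h2
    exact le_antisymm h2 h1

/-- If the value `k` moves inside `[u, v]` from `u⁻¹ k` to `v⁻¹ k` and `u`, `v` have the same
odd diagram, then all positions in between that carry values `≥ k` have the same parity. -/
theorem modEq_of_oddDiagram_eq {u v : Perm (Fin n)} (h : oddDiagram u = oddDiagram v) {k : Fin n}
    (hk : ∀ x, u x < k ↔ v x < k) (hlt : u⁻¹ k < v⁻¹ k) {x : Fin n} (h1 : u⁻¹ k ≤ x)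
    (h2 : x ≤ v⁻¹ k) (hx : k ≤ u x) : ((u⁻¹ k : Fin n) : ℕ) ≡ x [MOD 2] := by
  have hD (x : Fin n) : (k < u x ∧ x < u⁻¹ k ∧ ¬ (x : ℕ) ≡ (u⁻¹ k : Fin n) [MOD 2]) ↔
      (k < v x ∧ x < v⁻¹ k ∧ ¬ (x : ℕ) ≡ (v⁻¹ k : Fin n) [MOD 2]) :=
    Set.ext_iff.1 h (x, k)
  have hua : u (u⁻¹ k) = k := by simp
  have hvb : v (v⁻¹ k) = k := by simp
  generalize u⁻¹ k = a at *
  generalize v⁻¹ k = b at *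
  have hgt (y : Fin n) (hy : k ≤ u y) (hyb : y ≠ b) : k < v y :=
    lt_of_le_of_ne (not_lt.1 ((hk y).not.1 (not_lt.2 hy)))
      fun e => hyb (v.injective (hvb.trans e)).symm
  -- In `u`, column `k` has boxes only in rows above `a`. A row in `[a, b)` with entry `> k` and
  -- parity other than that of `b` would give a box in that column for `v`.
  have hab : (a : ℕ) ≡ b [MOD 2] := by
    by_contra hc
    exact lt_irrefl _ ((hD a).2 ⟨hgt a hua.ge hlt.ne, hlt, hc⟩).2.1
  by_contra hc
  have hxb : x ≠ b := by rintro rfl; exact hc hab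
  exact absurd ((hD x).2 ⟨hgt x hx hxb, lt_of_le_of_ne h2 hxb,
    fun e => hc (hab.trans e.symm)⟩).2.1 (not_lt.2 h1)

/-- If row `j` of the odd diagram of `w` is empty beyond column `k`, then entries above `k` to the
right of `j` in positions of the other parity exceed `w j`. -/
theorem apply_lt_of_row {w : Perm (Fin n)} {k j x : Fin n}
    (hrow : ∀ y, (j, y) ∈ oddDiagram w → y ≤ k) (hjx : j < x)
    (hpar : ¬ (j : ℕ) ≡ x [MOD 2]) (hx : k < w x) : w j < w x := by
  by_contra hc
  have hne : w x ≠ w j := fun e => hjx.ne (w.injective e).symm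
  exact absurd (hrow (w x) ((mk_apply_mem_oddDiagram w j x).2
    ⟨lt_of_le_of_ne (not_lt.1 hc) hne, hjx, hpar⟩)) (not_le.2 hx)

end OddDiagram

/-! ### The block decomposition -/

open OddDiagram in
theorem theorem3p5 {n : ℕ} (D : Set (Fin n × Fin n)) (u v : Equiv.Perm (Fin n))
    -- the odd diagram class of `D` is the Bruhat interval `[u, v]`, with more than one element
    (hclass : OddDiagram.bruhatInterval u v = OddDiagram.oddDiagramClass D)
    (hcard : 1 < (OddDiagram.bruhatInterval u v).ncard)
    -- `k = d(u, v)`, `a = u⁻¹(k)`, `b = v⁻¹(k)`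
    (k a b : Fin n) (hk : OddDiagram.IsFirstDiff u v k) (ha : a = u⁻¹ k) (hb : b = v⁻¹ k)
    -- `p 0 < ⋯ < p (m - 1)` lists the positions in question
    (m : ℕ) (p : Fin m → Fin n) (hp : StrictMono p)
    (hrange : Set.range p = OddDiagram.positions u a b) :
    (a < b ∧ u a < u b) ∧
    -- the blocks partition `[u, v]`
    (∀ i, (OddDiagram.block u v k (p i)).Nonempty) ∧
    (∀ i j, i ≠ j → Disjoint (OddDiagram.block u v k (p i)) (OddDiagram.block u v k (p j))) ∧
    (⋃ i, OddDiagram.block u v k (p i)) = OddDiagram.bruhatInterval u v ∧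
    -- all blocks have the same size
    (∀ i j, (OddDiagram.block u v k (p i)).ncard = (OddDiagram.block u v k (p j)).ncard) ∧
    -- the bijection between consecutive blocks, and the covering relation
    (∀ i j : Fin m, (i : ℕ) + 1 = j →
      Set.BijOn (fun w => w * Equiv.swap (p i) (p j))
        (OddDiagram.block u v k (p i)) (OddDiagram.block u v k (p j)) ∧
      ∀ w ∈ OddDiagram.block u v k (p i),
        OddDiagram.BruhatCovBy w (w * Equiv.swap (p i) (p j))) := by
  subst ha hb
  have hle : BruhatLE u v := by
    obtain ⟨w, hw⟩ := Set.nonempty_of_ncard_ne_zero (by omega : (bruhatInterval u v).ncard ≠ 0)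
    exact hw.1.trans hw.2
  have hmem (w) : w ∈ bruhatInterval u v ↔ oddDiagram w = D := by rw [hclass]; rfl
  have hu : u ∈ bruhatInterval u v := ⟨.refl, hle⟩
  have hv : v ∈ bruhatInterval u v := ⟨hle, .refl⟩
  have hkl : ∀ i < k, u⁻¹ i = v⁻¹ i := fun i hi => by_contra fun h => not_lt.2 (hk.2 h) hi
  have hfix {w} (hw : w ∈ bruhatInterval u v) (x) : u x < k ↔ w x < k := by
    constructor <;> intro h
    · have := inv_apply_eq_of_mem hw hkl _ h
      rw [show u⁻¹ (u x) = x by simp, Equiv.Perm.inv_eq_iff_eq] at this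
      rwa [← this]
    · have := inv_apply_eq_of_mem hw hkl _ h
      rw [show w⁻¹ (w x) = x by simp, eq_comm, Equiv.Perm.inv_eq_iff_eq] at this
      rwa [← this]
  have hbetween {w} (hw : w ∈ bruhatInterval u v) : u⁻¹ k ≤ w⁻¹ k ∧ w⁻¹ k ≤ v⁻¹ k :=
    ⟨hw.1.inv_apply_le fun i hi => (inv_apply_eq_of_mem hw hkl i hi).symm,
      hw.2.inv_apply_le fun i hi => (inv_apply_eq_of_mem hw hkl i hi).trans (hkl i hi)⟩
  have hab : u⁻¹ k < v⁻¹ k := lt_of_le_of_ne (hbetween hv).1 hk.1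
  have hpar {x} := modEq_of_oddDiagram_eq (((hmem u).1 hu).trans ((hmem v).1 hv).symm)
    (hfix hv) hab (x := x)
  have hua : u (u⁻¹ k) = k := by simp
  have hrow {w} (hw : w ∈ bruhatInterval u v) (y) (hy : (w⁻¹ k, y) ∈ D) : y ≤ k := by
    rw [← (hmem w).1 hw] at hy
    simpa using hy.1.le
  have hlow {w} (hw : w ∈ bruhatInterval u v) {x} : k ≤ u x ↔ k ≤ w x := by
    rw [← not_lt, hfix hw, not_lt]
  have hubk : k < u (v⁻¹ k) := by
    refine lt_of_le_of_ne ((hlow hv).2 (by simp)) fun e => hab.ne ?_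
    rw [Equiv.Perm.inv_eq_iff_eq]
    exact e
  have hsmall {w} (hw : w ∈ bruhatInterval u v) {i x} (hi : u⁻¹ k ≤ i ∧ i ≤ v⁻¹ k ∧ k ≤ u i)
      (h1 : u⁻¹ k ≤ x) (h2 : x ≤ v⁻¹ k) (hx : ¬ (i : ℕ) ≡ x [MOD 2]) : w x < k := by
    by_contra hc
    exact hx ((hpar hi.1 hi.2.1 hi.2.2).symm.trans (hpar h1 h2 ((hlow hw).2 (not_lt.1 hc))))
  -- For exchanges down and up alike, the row assumed empty beyond column `k` is that of the larger
  -- entry; this keeps entries to the right from separating the two exchanged values.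
  have hdown {w} (hw : w ∈ bruhatInterval u v) {i j} (hij : i < j) (hwij : w j < w i)
      (hi : u⁻¹ k ≤ i ∧ i ≤ v⁻¹ k ∧ k ≤ u i) (hj : u⁻¹ k ≤ j ∧ j ≤ v⁻¹ k ∧ k ≤ u j)
      (hri : ∀ y, (i, y) ∈ D → y ≤ k) : w * Equiv.swap i j ∈ bruhatInterval u v := by
    have hkj := (hlow hw).1 hj.2.2
    rw [hmem, ← (hmem w).1 hw]
    refine oddDiagram_mul_swap_of_gt w hij hwij
      ((hpar hi.1 hi.2.1 hi.2.2).symm.trans (hpar hj.1 hj.2.1 hj.2.2))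
      (fun x h1 h2 h3 => (hsmall hw hi (hi.1.trans h1.le) (h2.le.trans hj.2.1) h3).trans_le hkj)
      fun x h1 h2 h3 => apply_lt_of_row (k := k) ?_ (hij.trans h1) h2 (hkj.trans_lt h3)
    rwa [(hmem w).1 hw]
  have hup {w} (hw : w ∈ bruhatInterval u v) {i j} (hij : i < j) (hwij : w i < w j)
      (hi : u⁻¹ k ≤ i ∧ i ≤ v⁻¹ k ∧ k ≤ u i) (hj : u⁻¹ k ≤ j ∧ j ≤ v⁻¹ k ∧ k ≤ u j)
      (hrj : ∀ y, (j, y) ∈ D → y ≤ k) : w * Equiv.swap i j ∈ bruhatInterval u v := by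
    have hki := (hlow hw).1 hi.2.2
    have hijp := (hpar hi.1 hi.2.1 hi.2.2).symm.trans (hpar hj.1 hj.2.1 hj.2.2)
    rw [hmem, ← (hmem w).1 hw]
    refine oddDiagram_mul_swap w hij hwij hijp
      (fun x h1 h2 h3 => (hsmall hw hi (hi.1.trans h1.le) (h2.le.trans hj.2.1) h3).trans_le hki)
      fun x h1 h2 h3 => apply_lt_of_row (k := k) ?_ h1 (fun e => h2 (hijp.trans e))
        (hki.trans_lt h3)
    rwa [(hmem w).1 hw]
  -- a position with a nonempty row beyond column `k` carries a box of another parity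
  have hbox {x} (hx : u⁻¹ k ≤ x ∧ x ≤ v⁻¹ k ∧ k ≤ u x) {y} (hy : (x, y) ∈ D) (hyk : k < y)
      {w} (hw : w ∈ bruhatInterval u v) : ∃ z, v⁻¹ k < z ∧ k < w z ∧ w z < w x ∧
        ∀ i, u⁻¹ k ≤ i → i ≤ v⁻¹ k → k ≤ u i → ¬ (i : ℕ) ≡ z [MOD 2] := by
    rw [← (hmem w).1 hw] at hy
    obtain ⟨z, rfl⟩ := w.surjective y
    rw [mk_apply_mem_oddDiagram] at hy
    refine ⟨z, ?_, hyk, hy.1, fun i h1 h2 h3 e => hy.2.2 ?_⟩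
    · by_contra! hc
      exact absurd (hsmall hw hx (hx.1.trans hy.2.1.le) hc hy.2.2) (not_lt.2 hyk.le)
    · exact ((hpar hx.1 hx.2.1 hx.2.2).symm.trans (hpar h1 h2 h3)).trans e
  have hnobox {w} (hw : w ∈ bruhatInterval u v) {i} (hri : ∀ y, (i, y) ∈ D → y ≤ k)
      {z} (hz : i < z) (hzk : k < w z) (hp : ¬ (i : ℕ) ≡ z [MOD 2]) : w i < w z := by
    rw [← (hmem w).1 hw] at hri
    exact apply_lt_of_row hri hz hp hzk
  have hpos (x) : x ∈ positions u (u⁻¹ k) (v⁻¹ k) ↔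
      (u⁻¹ k ≤ x ∧ x ≤ v⁻¹ k ∧ k ≤ u x) ∧ ∀ y, (x, y) ∈ D → y ≤ k := by
    constructor
    · rintro ⟨h1, h2, h3, h4⟩
      rw [hua] at h3
      refine ⟨⟨h1, h2, h3⟩, fun y hy => ?_⟩
      by_contra! hc
      obtain ⟨z, hz, hkz, hzx, hzp⟩ := hbox ⟨h1, h2, h3⟩ hy hc hu
      -- Row `v⁻¹ k` of `D` is empty beyond column `k`, as seen from `v`, so `u z` exceeds `u (v⁻¹
      -- k)`.
      exact absurd (hnobox hu (hrow hv) hz hkz (hzp _ hab.le le_rfl hubk.le))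
        (not_lt.2 (hzx.le.trans h4))
    · rintro ⟨⟨h1, h2, h3⟩, hr⟩
      refine ⟨h1, h2, by rwa [hua], ?_⟩
      by_contra! hc
      have hxb : x < v⁻¹ k := lt_of_le_of_ne h2 (by rintro rfl; exact lt_irrefl _ hc)
      -- Otherwise an exchange would produce an element of the interval strictly below its minimum
      -- `u`.
      have hmem' := hdown hu hxb hc ⟨h1, h2, h3⟩ ⟨hab.le, le_rfl, hubk.le⟩ hr
      refine not_bruhatLE_of_step ⟨x, v⁻¹ k, hxb, ?_, ?_⟩ hmem'.1
      · simpa using hc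
      · rw [Equiv.mul_swap_mul_self]
  have hpp (i) := (hpos (p i)).1 (hrange ▸ Set.mem_range_self i)
  have hblock {w} (hw : w ∈ bruhatInterval u v) : ∃ i, p i = w⁻¹ k := by
    have : w⁻¹ k ∈ Set.range p := by
      rw [hrange, hpos]
      exact ⟨⟨(hbetween hw).1, (hbetween hw).2, (hlow hw).2 (by simp)⟩, hrow hw⟩
    exact this
  have hswap (i j : Fin m) {w} (hw : w ∈ block u v k (p i)) :
      w * Equiv.swap (p i) (p j) ∈ block u v k (p j) := by
    obtain ⟨hw, hwi⟩ := hw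
    have hwk : w (p i) = k := by rw [← hwi]; simp
    refine ⟨?_, by rw [Equiv.Perm.inv_eq_iff_eq]; simp [hwk]⟩
    rcases eq_or_ne (p i) (p j) with e | hne
    · rw [e, Equiv.swap_self]
      exact hw
    have hlt : w (p i) < w (p j) :=
      lt_of_le_of_ne (hwk ▸ (hlow hw).1 (hpp j).1.2.2) fun e => hne (w.injective e)
    rcases lt_or_gt_of_ne hne with h | h
    · exact hup hw h hlt (hpp i).1 (hpp j).1 (hpp j).2
    · rw [Equiv.swap_comm]
      exact hdown hw h hlt (hpp j).1 (hpp i).1 (hpp j).2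
  have hbij (i j : Fin m) : Set.BijOn (fun w => w * Equiv.swap (p i) (p j))
      (block u v k (p i)) (block u v k (p j)) := by
    refine ⟨fun w hw => hswap i j hw, (mul_left_injective _).injOn, fun w hw =>
      ⟨w * Equiv.swap (p j) (p i), hswap j i hw, ?_⟩⟩
    simp only
    rw [Equiv.swap_comm, Equiv.mul_swap_mul_self]
  refine ⟨⟨hab, hua.trans_lt hubk⟩, fun i => ?_, fun i j hij => ?_, ?_, fun i j => ?_,
    fun i j hij => ⟨hbij i j, fun w hw => ?_⟩⟩
  · obtain ⟨i₀, h₀⟩ := hblock hu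
    exact ⟨_, hswap i₀ i ⟨hu, h₀.symm⟩⟩
  · rw [Set.disjoint_left]
    exact fun w hi hj => hij (hp.injective (hi.2.symm.trans hj.2))
  · ext w
    rw [Set.mem_iUnion]
    refine ⟨fun ⟨i, hi⟩ => hi.1, fun hw => ?_⟩
    obtain ⟨i, hi⟩ := hblock hw
    exact ⟨i, hw, hi.symm⟩
  · rw [← (hbij i j).image_eq, Set.ncard_image_of_injective _ (mul_left_injective _)]
  · have hij' : p i < p j := hp (Fin.lt_def.2 (by omega))
    have hwk : w (p i) = k := by rw [← hw.2]; simp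
    refine bruhatCovBy_mul_swap w hij' (lt_of_le_of_ne (hwk ▸ (hlow hw.1).1 (hpp j).1.2.2)
      fun e => hij'.ne (w.injective e)) fun x h1 h2 h3 => ?_
    rw [hwk] at h3
    have hx : u⁻¹ k ≤ x ∧ x ≤ v⁻¹ k ∧ k ≤ u x :=
      ⟨(hpp i).1.1.trans h1.le, h2.le.trans (hpp j).1.2.1, (hlow hw.1).2 h3.le⟩
    -- No listed position lies strictly between `p i` and `p j`, so row `x` has a box beyond column
    -- `k`.
    have hnot : ¬ ∀ y, (x, y) ∈ D → y ≤ k := by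
      intro hc
      obtain ⟨l, rfl⟩ : x ∈ Set.range p := hrange ▸ (hpos x).2 ⟨hx, hc⟩
      have := Fin.lt_def.1 (hp.lt_iff_lt.1 h1)
      have := Fin.lt_def.1 (hp.lt_iff_lt.1 h2)
      omega
    push Not at hnot
    obtain ⟨y, hy, hyk⟩ := hnot
    obtain ⟨z, hz, hkz, hzx, hzp⟩ := hbox hx hy hyk hw.1
    exact (hnobox hw.1 (hpp j).2 ((hpp j).1.2.1.trans_lt hz) hkz
      (hzp _ (hpp j).1.1 (hpp j).1.2.1 (hpp j).1.2.2)).trans hzx
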